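/- Let $n\ge 1$ and $d\ge 1$ be integers and write $e(t)=\exp(2\pi i t)$. Let $X\subseteq(\mathbb Z/n\mathbb Z)^d$ be the set of all distinct vectors obtained by permuting the coordinates of $(1,1,\ldots,1,1-d)$, and define $\sigma_X:(\mathbb Z/n\mathbb Z)^d\to\mathbb C$ by $$\sigma_X(\vec y)=\sum_{\vec x\in X} e\!\left(\frac{\vec x\cdot\vec y}{n}\right),\qquad \vec x\cdot\vec y=\sum_{i=1}^d x_iy_i .$$ Let $H_d\subset\mathbb C=\mathbb R^2$ be the hypocycloid with parametric equations $$x(\theta)=(d-1)\cos\theta+\cos[(d-1)\theta],\qquad y(\theta)=(d-1)\sin\theta-\sin[(d-1)\theta],\qquad \theta\in\mathbb R$$ (for $d=1$ and $d=2$ it degenerates to the point $1$ and to the segment $[-2,2]$, respectively). Then the image $\sigma_X\big((\mathbb Z/n\mathbb Z)^d\big)$ is contained in the filled hypocycloid, that is, in the union of $H_d$ and all bounded connected components of $\mathbb C\setminus H_d$. -/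

import Mathlib

/-- The orbit `S_d x = {π(x) : π ∈ S_d}` of a vector `x ∈ (ℤ/nℤ)^d` under permutation of its
coordinates, as a set (each vector of the orbit occurs once). -/
def symmOrbit {n d : ℕ} (x : Fin d → ZMod n) : Finset (Fin d → ZMod n) :=
  (Finset.univ : Finset (Equiv.Perm (Fin d))).image fun π i => x (π.symm i)

/-- `σ_X(y) = ∑_{x ∈ X} e((x · y) / n)` with `e(t) = exp(2πit)`. Mathlib's `ZMod.stdAddChar`
is the map `ℤ/nℤ → ℂ`, `j ↦ exp(2πij/n)`. -/
noncomputable def symmSupercharacter {n d : ℕ} [NeZero n]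
    (X : Finset (Fin d → ZMod n)) (y : Fin d → ZMod n) : ℂ :=
  ∑ x ∈ X, ZMod.stdAddChar (∑ i, x i * y i)

/-- The vector `(1, 1, …, 1, 1 - d)` of `(ℤ/nℤ)^d`. -/
def hypoVector (n d : ℕ) (i : Fin d) : ZMod n :=
  if (i : ℕ) + 1 = d then 1 - (d : ZMod n) else 1

/-- The hypocycloid traced by a point of a circle of radius `1` that rolls inside a circle of
radius `d` centered at the origin, in the plane `ℝ² = ℂ`. -/
noncomputable def hypocycloid (d : ℕ) : Set ℂ :=
  Set.range fun θ : ℝ =>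
    (⟨((d : ℝ) - 1) * Real.cos θ + Real.cos (((d : ℝ) - 1) * θ),
      ((d : ℝ) - 1) * Real.sin θ - Real.sin (((d : ℝ) - 1) * θ)⟩ : ℂ)

/-- A plane set `K` together with all points it encloses, i.e. together with the bounded
connected components of its complement. For a closed curve `K` this is the filled curve. -/
def filled (K : Set ℂ) : Set ℂ :=
  K ∪ {z | z ∈ Kᶜ ∧ Bornology.IsBounded (connectedComponentIn Kᶜ z)}

/-! Each value of the character sum is a sum of `d` unit complex numbers with product 1
(`symmSupercharacter_mem_unitaryTraces`), so it suffices to enclose the compact set T of all such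
sums. Unless `d - 1` of the numbers coincide, which gives a point of the curve, there are three
distinct values or two values each occurring twice; in both cases the sum is interior to T
(`mem_hypocycloid_or_mem_nhds`). Hence T is relatively clopen off the curve, and a component of the
complement that meets T stays in T, so it is bounded. -/

theorem Circle.re_exp (t : ℝ) : (Circle.exp t : ℂ).re = Real.cos t := by
  rw [Circle.coe_exp, Complex.exp_ofReal_mul_I_re]

theorem Circle.im_exp (t : ℝ) : (Circle.exp t : ℂ).im = Real.sin t := by
  rw [Circle.coe_exp, Complex.exp_ofReal_mul_I_im]

/-! ### Sums of unit numbers with product 1 -/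

/-- The sums of `d` complex numbers of modulus `1` whose product is `1`, that is, the traces of the
matrices in `SU(d)`. -/
def unitaryTraces (d : ℕ) : Set ℂ :=
  {z | ∃ s : Multiset Circle, s.card = d ∧ s.prod = 1 ∧ (s.map (fun u : Circle => (u : ℂ))).sum = z}

theorem isCompact_unitaryTraces (d : ℕ) : IsCompact (unitaryTraces d) := by
  have h : unitaryTraces d =
      (fun f : Fin d → Circle => ∑ i, (f i : ℂ)) '' {f | ∏ i, f i = 1} := by
    ext z
    constructor
    · rintro ⟨s, hs, hp, hz⟩
      induction s using Quotient.inductionOn with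
      | h l =>
        simp only [Multiset.quot_mk_to_coe, Multiset.coe_card, Multiset.prod_coe,
          Multiset.map_coe, Multiset.sum_coe] at hs hp hz
        subst hs
        refine ⟨l.get, ?_, ?_⟩
        · simpa [← List.prod_ofFn] using hp
        · simpa [← hz] using Fin.sum_univ_fun_getElem l (fun u : Circle => (u : ℂ))
    · rintro ⟨f, hf, rfl⟩
      refine ⟨Finset.univ.val.map f, by simp, hf, ?_⟩
      rw [Multiset.map_map]
      rfl
  rw [h]
  refine IsCompact.image (IsClosed.isCompact ?_) (by fun_prop)
  exact isClosed_eq (by fun_prop) continuous_const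

theorem smul_mem_unitaryTraces {d : ℕ} {w : Circle} (hw : w ^ d = 1) {z : ℂ}
    (hz : z ∈ unitaryTraces d) : (w : ℂ) * z ∈ unitaryTraces d := by
  obtain ⟨s, hs, hp, rfl⟩ := hz
  refine ⟨s.map (w * ·), by simpa using hs, ?_, ?_⟩
  · rw [Multiset.prod_map_mul]
    simp [hs, hw, hp]
  · rw [Multiset.map_map, ← Multiset.sum_map_mul_left]
    simp [Function.comp_def]

/-- Serves the case `d = 0` in `ZMod n`, where the character sum has a single term. Adjoining i and
-i changes neither sum nor product, so `d` can grow by 2. -/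
theorem one_mem_unitaryTraces : ∀ d : ℕ, 1 ≤ d → (1 : ℂ) ∈ unitaryTraces d
  | 1, _ => ⟨{1}, by simp⟩
  | 2, _ => by
    refine ⟨{Circle.exp (Real.pi / 3), Circle.exp (-(Real.pi / 3))}, by simp, ?_, ?_⟩
    · simp
    · simp only [Multiset.insert_eq_cons, Multiset.map_cons, Multiset.map_singleton,
        Multiset.sum_cons, Multiset.sum_singleton, Circle.coe_exp]
      apply Complex.ext <;> simp [Complex.exp_re, Complex.exp_im]
      norm_num
  | d + 3, _ => by
    obtain ⟨s, hs, hp, hz⟩ := one_mem_unitaryTraces (d + 1) (by omega)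
    refine ⟨Circle.exp (Real.pi / 2) ::ₘ Circle.exp (-(Real.pi / 2)) ::ₘ s, by simp [hs], ?_, ?_⟩
    · rw [Multiset.prod_cons, Multiset.prod_cons, ← mul_assoc, ← Circle.exp_add, hp]
      simp
    · simp only [Multiset.map_cons, Multiset.sum_cons, hz, Circle.coe_exp]
      apply Complex.ext <;> simp [Complex.exp_re, Complex.exp_im]

/-! ### Interior points -/

/-- Three distinct points of the unit circle are not collinear. -/
theorem Circle.im_conj_sub_mul_sub_ne_zero {u v w : Circle} (huv : u ≠ v) (huw : u ≠ w)
    (hvw : v ≠ w) : (starRingEnd ℂ ((u : ℂ) - w) * ((v : ℂ) - w)).im ≠ 0 := by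
  intro h
  have h1 := Complex.conj_eq_iff_im.2 h
  simp only [map_mul, map_sub, Complex.conj_conj] at h1
  -- On the circle conjugation is inversion, so collinearity becomes a polynomial identity that
  -- factors into differences.
  simp only [← Circle.coe_inv_eq_conj, Circle.coe_inv] at h1
  have hu := Circle.coe_ne_zero u
  have hv := Circle.coe_ne_zero v
  have hw := Circle.coe_ne_zero w
  have huv' : (u : ℂ) - v ≠ 0 := sub_ne_zero.2 fun h => huv (Circle.ext h)
  have huw' : (u : ℂ) - w ≠ 0 := sub_ne_zero.2 fun h => huw (Circle.ext h)
  have hvw' : (v : ℂ) - w ≠ 0 := sub_ne_zero.2 fun h => hvw (Circle.ext h)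
  field_simp at h1
  have h2 : ((u : ℂ) - v) * ((u : ℂ) - w) * ((v : ℂ) - w) = 0 := by
    linear_combination -h1
  exact mul_ne_zero (mul_ne_zero huv' huw') hvw' h2

theorem exists_real_combination_of_im_ne_zero {p q : ℂ} (h : (starRingEnd ℂ p * q).im ≠ 0) (z : ℂ) :
    ∃ a b : ℝ, a * p + b * q = z := by
  set D := (starRingEnd ℂ p * q).im with hD
  simp only [Complex.mul_im, Complex.conj_re, Complex.conj_im] at hD
  refine ⟨(z.re * q.im - z.im * q.re) / D, (p.re * z.im - p.im * z.re) / D, ?_⟩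
  apply Complex.ext
  · simp only [Complex.add_re, Complex.re_ofReal_mul]
    field_simp
    rw [hD]
    ring
  · simp only [Complex.add_im, Complex.im_ofReal_mul]
    field_simp
    rw [hD]
    ring

/-- Moving three distinct points on the unit circle with fixed product moves their sum in all
directions. -/
theorem eventually_exists_sum_of_three {u v w : Circle} (huv : u ≠ v) (huw : u ≠ w)
    (hvw : v ≠ w) :
    ∀ᶠ z in nhds ((u : ℂ) + v + w), ∃ u' v' w' : Circle,
      u' * v' * w' = u * v * w ∧ (u' : ℂ) + v' + w' = z := by
  -- The three rotation angles add up to 0, which keeps the product. The differential at 0 is onto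
  -- because `u - w` and `v - w` are independent over ℝ.
  let F : ℝ × ℝ → ℂ := fun x =>
    u * Complex.exp (x.1 * Complex.I) + v * Complex.exp (x.2 * Complex.I)
      + w * Complex.exp ((-(x.1 + x.2) : ℝ) * Complex.I)
  have hc : ContDiff ℝ 1 F := by
    have hof : ContDiff ℝ 1 (fun x : ℝ => (x : ℂ)) := Complex.ofRealCLM.contDiff
    refine ContDiff.add (ContDiff.add ?_ ?_) ?_
    · exact contDiff_const.mul (((hof.comp contDiff_fst).mul contDiff_const).cexp)
    · exact contDiff_const.mul (((hof.comp contDiff_snd).mul contDiff_const).cexp)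
    · exact contDiff_const.mul
        (((hof.comp (contDiff_fst.add contDiff_snd).neg).mul contDiff_const).cexp)
  have hs : HasStrictFDerivAt F (fderiv ℝ F 0) 0 :=
    hc.contDiffAt.hasStrictFDerivAt (by norm_num)
  have hline : ∀ a b : ℝ, fderiv ℝ F 0 (a, b) =
      Complex.I * (a * ((u : ℂ) - w) + b * ((v : ℂ) - w)) := by
    intro a b
    have hg : HasDerivAt (fun t : ℝ => t • (a, b)) (a, b) 0 := by
      simpa using (hasDerivAt_id (0 : ℝ)).smul_const (a, b)
    have h0 : HasFDerivAt F (fderiv ℝ F 0) ((0 : ℝ) • (a, b)) := by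
      simpa using hs.hasFDerivAt
    have h1 := h0.comp_hasDerivAt (0 : ℝ) hg
    have hexp : ∀ c : ℝ, HasDerivAt (fun t : ℝ => Complex.exp (((t * c : ℝ) : ℂ) * Complex.I))
        (c * Complex.I) 0 := by
      intro c
      have h2 : HasDerivAt (fun t : ℝ => ((t * c : ℝ) : ℂ)) (c : ℂ) 0 := by
        simpa using ((hasDerivAt_id (0 : ℝ)).mul_const c).ofReal_comp
      simpa using (h2.mul_const Complex.I).cexp
    have h3 := (((hexp a).const_mul (u : ℂ)).add ((hexp b).const_mul (v : ℂ))).add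
      ((hexp (-(a + b))).const_mul (w : ℂ))
    have h4 := h1.unique (h3.congr_of_eventuallyEq (Filter.Eventually.of_forall fun t => by
      simp only [Function.comp, F, Prod.smul_mk, smul_eq_mul, Pi.add_apply]
      congr 5
      ring))
    rw [h4]
    push_cast
    ring
  have hsurj : (fderiv ℝ F 0).range = ⊤ := by
    rw [LinearMap.range_eq_top]
    intro z
    obtain ⟨a, b, hab⟩ := exists_real_combination_of_im_ne_zero
      (Circle.im_conj_sub_mul_sub_ne_zero huv huw hvw) (-Complex.I * z)
    refine ⟨(a, b), ?_⟩
    refine (hline a b).trans ?_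
    rw [hab, ← mul_assoc, mul_neg, Complex.I_mul_I]
    simp
  have hm := hs.map_nhds_eq_of_surj hsurj
  have hF0 : F 0 = (u : ℂ) + v + w := by simp [F]
  rw [← hF0, ← hm, Filter.eventually_map]
  refine Filter.Eventually.of_forall fun x => ?_
  refine ⟨u * Circle.exp x.1, v * Circle.exp x.2, w * Circle.exp (-(x.1 + x.2)), ?_, ?_⟩
  · have h : Circle.exp x.1 * Circle.exp x.2 * Circle.exp (-(x.1 + x.2)) = 1 := by
      rw [← Circle.exp_add, ← Circle.exp_add]
      simp
    calc _ = u * v * w * (Circle.exp x.1 * Circle.exp x.2 * Circle.exp (-(x.1 + x.2))) := by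
          simp only [mul_assoc, mul_left_comm, mul_comm]
      _ = _ := by rw [h, mul_one]
  · simp only [Circle.coe_mul, Circle.coe_exp, F]

theorem unitaryTraces_mem_nhds_of_three {u v w : Circle} {r : Multiset Circle} (huv : u ≠ v)
    (huw : u ≠ w) (hvw : v ≠ w) (hp : (u ::ₘ v ::ₘ w ::ₘ r).prod = 1) :
    unitaryTraces (u ::ₘ v ::ₘ w ::ₘ r).card ∈
      nhds ((u ::ₘ v ::ₘ w ::ₘ r).map (fun u : Circle => (u : ℂ))).sum := by
  set S := (r.map (fun u : Circle => (u : ℂ))).sum with hS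
  have hsum : ((u ::ₘ v ::ₘ w ::ₘ r).map (fun u : Circle => (u : ℂ))).sum
      = (u : ℂ) + v + w + S := by
    simp [hS, add_assoc]
  rw [hsum]
  have ht : Filter.Tendsto (fun z : ℂ => z - S) (nhds ((u : ℂ) + v + w + S))
      (nhds ((u : ℂ) + v + w)) := by
    have := (continuous_sub_right S).tendsto ((u : ℂ) + v + w + S)
    rwa [add_sub_cancel_right] at this
  filter_upwards [ht.eventually (eventually_exists_sum_of_three huv huw hvw)] with z hz
  obtain ⟨u', v', w', hp', hs'⟩ := hz
  refine ⟨u' ::ₘ v' ::ₘ w' ::ₘ r, by simp, ?_, ?_⟩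
  · rw [← hp]
    simp only [Multiset.prod_cons, ← mul_assoc, hp']
  · simp only [Multiset.map_cons, Multiset.sum_cons, ← hS, ← add_assoc, hs', sub_add_cancel]

/-- Two pairs of equal points on the unit circle have the same sum and product as some four points
of which three are distinct. -/
theorem exists_four_of_two_pairs {u v : Circle} (huv : u ≠ v) :
    ∃ a b c e : Circle, a ≠ b ∧ a ≠ c ∧ b ≠ c ∧ a * b * c * e = u * u * v * v ∧
      (a : ℂ) + b + c + e = u + u + v + v := by
  -- Here `m` is a square root of `u * v`. The pairs become `m` times conjugate pairs, whose sums
  -- depend only on cosines; shifting one cosine by δ and the other by -δ keeps the total.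
  obtain ⟨m, α, rfl, rfl⟩ : ∃ (m : Circle) (α : ℝ), u = m * Circle.exp α ∧
      v = m * Circle.exp (-α) := by
    obtain ⟨x, rfl⟩ := Circle.exp_surjective u
    obtain ⟨y, rfl⟩ := Circle.exp_surjective v
    refine ⟨Circle.exp ((x + y) / 2), (x - y) / 2, ?_, ?_⟩ <;> rw [← Circle.exp_add] <;>
      congr 1 <;> ring
  have hsin : Real.sin α ≠ 0 := by
    intro h
    apply huv
    congr 1
    apply Circle.ext
    apply Complex.ext <;> simp only [Circle.re_exp, Circle.im_exp, Real.cos_neg, Real.sin_neg, h,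
      neg_zero]
  have hcos : |Real.cos α| < 1 := by
    rw [← sq_lt_one_iff_abs_lt_one]
    have := Real.sin_sq_add_cos_sq α
    have := pow_pos (abs_pos.2 hsin) 2
    rw [sq_abs] at this
    linarith
  obtain ⟨h1, h2⟩ := abs_lt.1 hcos
  obtain ⟨δ, hδ, hδ1, hδ2⟩ : ∃ δ : ℝ, 0 < δ ∧ Real.cos α + δ < 1 ∧ -1 < Real.cos α - δ := by
    refine ⟨(1 - |Real.cos α|) / 2, by linarith, ?_, ?_⟩
    · linarith [le_abs_self (Real.cos α)]
    · linarith [neg_abs_le (Real.cos α)]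
  set A := Real.arccos (Real.cos α + δ)
  set B := Real.arccos (Real.cos α - δ)
  have hA : Real.cos A = Real.cos α + δ := Real.cos_arccos (by linarith) (by linarith)
  have hB : Real.cos B = Real.cos α - δ := Real.cos_arccos (by linarith) (by linarith)
  have hsA : Real.sin A ≠ 0 := by
    intro h
    have := Real.sin_sq_add_cos_sq A
    rw [h, hA] at this
    nlinarith
  refine ⟨m * Circle.exp A, m * Circle.exp (-A), m * Circle.exp B, m * Circle.exp (-B),
    ?_, ?_, ?_, ?_, ?_⟩
  · intro h
    have := congrArg (fun z : Circle => (z : ℂ).im) (mul_left_cancel h)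
    simp only [Circle.im_exp, Real.sin_neg] at this
    exact hsA (by linarith)
  · intro h
    have := congrArg (fun z : Circle => (z : ℂ).re) (mul_left_cancel h)
    simp only [Circle.re_exp, hA, hB] at this
    linarith
  · intro h
    have := congrArg (fun z : Circle => (z : ℂ).re) (mul_left_cancel h)
    simp only [Circle.re_exp, Real.cos_neg, hA, hB] at this
    linarith
  · simp only [Circle.exp_neg]
    have h : ∀ p q : Circle, m * p * (m * p⁻¹) * (m * q) * (m * q⁻¹) = m ^ 4 := by
      intro p q
      apply Circle.ext
      have := Circle.coe_ne_zero p
      have := Circle.coe_ne_zero q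
      push_cast
      field_simp
    rw [h, mul_right_comm (m * Circle.exp α), h]
  · have key : ∀ x : ℝ, ((Circle.exp x : Circle) : ℂ) + (Circle.exp (-x) : Circle)
        = ((2 * Real.cos x : ℝ) : ℂ) := by
      intro x
      apply Complex.ext <;> simp only [Complex.add_re, Complex.add_im, Circle.re_exp,
        Circle.im_exp, Real.cos_neg, Real.sin_neg, Complex.ofReal_re, Complex.ofReal_im] <;> ring
    have hk : ((2 * Real.cos A : ℝ) : ℂ) + ((2 * Real.cos B : ℝ) : ℂ)
        = ((2 * Real.cos α : ℝ) : ℂ) + ((2 * Real.cos α : ℝ) : ℂ) := by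
      rw [← Complex.ofReal_add, ← Complex.ofReal_add, hA, hB]
      congr 1
      ring
    rw [← key, ← key, ← key] at hk
    simp only [Circle.coe_mul]
    linear_combination (m : ℂ) * hk

/-- If `u` and `v` are the only values, the differential of the sum has rank one, so the same point
is first rewritten with three distinct entries. -/
theorem unitaryTraces_mem_nhds_of_two_pairs {u v : Circle} {r : Multiset Circle} (huv : u ≠ v)
    (hp : (u ::ₘ u ::ₘ v ::ₘ v ::ₘ r).prod = 1) :
    unitaryTraces (u ::ₘ u ::ₘ v ::ₘ v ::ₘ r).card ∈
      nhds ((u ::ₘ u ::ₘ v ::ₘ v ::ₘ r).map (fun u : Circle => (u : ℂ))).sum := by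
  obtain ⟨a, b, c, e, hab, hac, hbc, hprod, hsum⟩ := exists_four_of_two_pairs huv
  have h := unitaryTraces_mem_nhds_of_three (r := e ::ₘ r) hab hac hbc (by
    rw [← hp]
    simp only [Multiset.prod_cons, ← mul_assoc, hprod])
  simp only [Multiset.map_cons, Multiset.sum_cons, ← add_assoc, hsum, Multiset.card_cons] at h ⊢
  exact h

/-! ### The curve and its filling -/

theorem mem_hypocycloid_of_replicate {d : ℕ} {u v : Circle}
    (hp : (v ::ₘ Multiset.replicate d u).prod = 1) :
    ((v ::ₘ Multiset.replicate d u).map (fun u : Circle => (u : ℂ))).sum ∈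
      hypocycloid (d + 1) := by
  obtain ⟨θ, rfl⟩ := Circle.exp_surjective u
  rw [Multiset.prod_cons, Multiset.prod_replicate] at hp
  -- The product condition forces `v`, and the sum is the curve's parametrization at θ.
  have hv : v = Circle.exp (-(d * θ)) := by
    rw [Circle.exp_neg, eq_inv_of_mul_eq_one_left hp, Circle.exp_natCast_mul]
  refine ⟨θ, ?_⟩
  subst hv
  simp only [Multiset.map_cons, Multiset.map_replicate, Multiset.sum_cons, Multiset.sum_replicate,
    Circle.coe_exp, nsmul_eq_mul]
  apply Complex.ext
  · simp [Complex.exp_re, Complex.exp_im, -Complex.ofReal_neg, -Complex.ofReal_mul]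
    ring
  · simp [Complex.exp_re, Complex.exp_im, -Complex.ofReal_neg, -Complex.ofReal_mul]
    ring

theorem mem_hypocycloid_or_mem_nhds {d : ℕ} (hd : 1 ≤ d) {z : ℂ} (hz : z ∈ unitaryTraces d) :
    z ∈ hypocycloid d ∨ unitaryTraces d ∈ nhds z := by
  obtain ⟨s, rfl, hp, rfl⟩ := hz
  obtain ⟨u, hu⟩ := Multiset.card_pos_iff_exists_mem.1 hd
  obtain ⟨t, rfl⟩ := Multiset.exists_cons_of_mem hu
  by_cases hall : ∀ v ∈ t, v = u
  · left
    rw [Multiset.eq_replicate_card.2 hall] at hp ⊢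
    simpa using mem_hypocycloid_of_replicate hp
  push Not at hall
  obtain ⟨v, hv, hvu⟩ := hall
  obtain ⟨r, rfl⟩ := Multiset.exists_cons_of_mem hv
  by_cases h3 : ∃ w ∈ r, w ≠ u ∧ w ≠ v
  · obtain ⟨w, hw, hwu, hwv⟩ := h3
    obtain ⟨r, rfl⟩ := Multiset.exists_cons_of_mem hw
    exact Or.inr (unitaryTraces_mem_nhds_of_three hvu.symm hwu.symm hwv.symm hp)
  push Not at h3
  by_cases hru : u ∈ r
  · by_cases hrv : v ∈ r
    · right
      obtain ⟨r, rfl⟩ := Multiset.exists_cons_of_mem hru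
      have hrv' : v ∈ r := (Multiset.mem_cons.1 hrv).resolve_left hvu
      obtain ⟨r, rfl⟩ := Multiset.exists_cons_of_mem hrv'
      have hswap : u ::ₘ v ::ₘ u ::ₘ v ::ₘ r = u ::ₘ u ::ₘ v ::ₘ v ::ₘ r := by
        rw [Multiset.cons_swap v u]
      rw [hswap] at hp ⊢
      exact unitaryTraces_mem_nhds_of_two_pairs hvu.symm hp
    · left
      have hr : ∀ w ∈ r, w = u := fun w hw => by
        by_contra h
        exact hrv (h3 w hw h ▸ hw)
      rw [Multiset.cons_swap, Multiset.eq_replicate_card.2 hr, ← Multiset.replicate_succ] at hp ⊢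
      simpa using mem_hypocycloid_of_replicate hp
  · left
    have hr : ∀ w ∈ r, w = v := fun w hw => h3 w hw fun h => hru (h ▸ hw)
    rw [Multiset.eq_replicate_card.2 hr, ← Multiset.replicate_succ] at hp ⊢
    simpa using mem_hypocycloid_of_replicate hp

theorem unitaryTraces_subset_filled_hypocycloid {d : ℕ} (hd : 1 ≤ d) :
    unitaryTraces d ⊆ filled (hypocycloid d) := by
  intro z hz
  by_cases hzH : z ∈ hypocycloid d
  · exact Or.inl hzH
  have hint : unitaryTraces d ∩ (hypocycloid d)ᶜ ⊆ interior (unitaryTraces d) := fun x hx =>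
    mem_interior_iff_mem_nhds.2 ((mem_hypocycloid_or_mem_nhds hd hx.1).resolve_left hx.2)
  -- The interior and the complement of T are disjoint open sets covering the component.
  have hsub : connectedComponentIn (hypocycloid d)ᶜ z ⊆ interior (unitaryTraces d) := by
    refine isPreconnected_connectedComponentIn.subset_left_of_subset_union isOpen_interior
      (isCompact_unitaryTraces d).isClosed.isOpen_compl
      (disjoint_compl_right.mono_left interior_subset) (fun x hx => ?_)
      ⟨z, mem_connectedComponentIn hzH, hint ⟨hz, hzH⟩⟩
    by_cases hxT : x ∈ unitaryTraces d
    · exact Or.inl (hint ⟨hxT, connectedComponentIn_subset _ _ hx⟩)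
    · exact Or.inr hxT
  exact Or.inr ⟨hzH, (isCompact_unitaryTraces d).isBounded.subset (hsub.trans interior_subset)⟩

/-! ### The character sum -/

theorem symmOrbit_hypoVector (n d : ℕ) (hd : 1 ≤ d) :
    symmOrbit (hypoVector n d) =
      Finset.univ.image fun k i : Fin d => if i = k then 1 - (d : ZMod n) else 1 := by
  let l : Fin d := ⟨d - 1, by omega⟩
  have hl : ∀ i : Fin d, (i : ℕ) + 1 = d ↔ i = l := fun i => by
    rw [Fin.ext_iff]
    change _ ↔ (i : ℕ) = d - 1
    omega
  have hπ : ∀ π : Equiv.Perm (Fin d), (fun i => hypoVector n d (π.symm i)) =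
      fun i => if i = π l then 1 - (d : ZMod n) else 1 := fun π => by
    funext i
    simp only [hypoVector, hl, Equiv.symm_apply_eq]
  ext x
  simp only [symmOrbit, Finset.mem_image, Finset.mem_univ, true_and, hπ]
  constructor
  · rintro ⟨π, rfl⟩
    exact ⟨π l, rfl⟩
  · rintro ⟨k, rfl⟩
    exact ⟨Equiv.swap l k, by rw [Equiv.swap_apply_left]⟩

theorem symmSupercharacter_mem_unitaryTraces (n d : ℕ) [NeZero n] (hd : 1 ≤ d)
    (y : Fin d → ZMod n) :
    symmSupercharacter (symmOrbit (hypoVector n d)) y ∈ unitaryTraces d := by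
  rw [symmSupercharacter, symmOrbit_hypoVector n d hd]
  -- If `d = 0` in `ZMod n`, the orbit is the all-ones vector alone and the value is a `d`-th root
  -- of unity. Otherwise the `d` vectors are distinct, and their exponents add up to 0.
  by_cases h0 : (d : ZMod n) = 0
  · have : Nonempty (Fin d) := ⟨⟨0, hd⟩⟩
    have hconst : (fun k i : Fin d => if i = k then 1 - (d : ZMod n) else 1) =
        fun _ _ => 1 := by
      simp [h0]
    rw [hconst, Finset.image_const Finset.univ_nonempty, Finset.sum_singleton]
    simp only [one_mul]
    rw [ZMod.stdAddChar_apply, ← mul_one ((ZMod.toCircle _ : Circle) : ℂ)]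
    refine smul_mem_unitaryTraces ?_ (one_mem_unitaryTraces d hd)
    rw [← AddChar.map_nsmul_eq_pow, nsmul_eq_mul, h0, zero_mul, AddChar.map_zero_eq_one]
  · rw [Finset.sum_image]
    · have hdot : ∀ k : Fin d, ∑ i, (if i = k then 1 - (d : ZMod n) else 1) * y i
          = ∑ i, y i - (d : ZMod n) * y k := fun k => by
        have : ∀ i, (if i = k then 1 - (d : ZMod n) else 1) * y i
            = y i - if i = k then d * y i else 0 := fun i => by
          split_ifs <;> ring
        simp [this]
      simp only [hdot]
      refine ⟨Finset.univ.val.map fun k => ZMod.toCircle (∑ i, y i - (d : ZMod n) * y k), by simp, ?_, ?_⟩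
      · change ∏ k, ZMod.toCircle (∑ i, y i - (d : ZMod n) * y k) = 1
        refine (map_prod (ZMod.toCircle (N := n)).toMonoidHom
          (fun k => Multiplicative.ofAdd (∑ i, y i - (d : ZMod n) * y k)) Finset.univ).symm.trans ?_
        rw [← ofAdd_sum]
        simp [← Finset.mul_sum]
      · rw [Multiset.map_map]
        rfl
    · intro j _ k _ hjk
      by_contra hne
      have := congrFun hjk j
      simp [hne, h0] at this

theorem proposition2p4 (n d : ℕ) [NeZero n] (hd : 1 ≤ d) :
    Set.range (symmSupercharacter (symmOrbit (hypoVector n d))) ⊆ filled (hypocycloid d) := by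
  rintro _ ⟨y, rfl⟩
  exact unitaryTraces_subset_filled_hypocycloid hd (symmSupercharacter_mem_unitaryTraces n d hd y)
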